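/- Let $\Gamma$ be an infinite set and let $c_0(\Gamma)$ be the complex Banach space of all functions $x:\Gamma\to\mathbb{C}$ such that $\{n\in\Gamma : |x(n)|\geq\varepsilon\}$ is finite for every $\varepsilon>0$, with the norm $\|x\|=\sup_{n\in\Gamma}|x(n)|$. For $n\in\Gamma$ let $e_n\in c_0(\Gamma)$ be the function with $e_n(n)=1$ and $e_n(m)=0$ for $m\neq n$. Let $X$ be a complex Banach space, and write $S(\cdot)$ for the unit sphere. Then every surjective isometry $\Delta:S(c_0(\Gamma))\to S(X)$ (that is, a surjective map with $\|\Delta(x)-\Delta(y)\|=\|x-y\|$ for all $x,y$) extends to a unique surjective real-linear isometry $F:c_0(\Gamma)\to X$. Moreover, there are maps $\sigma_n:\mathbb{C}\to\mathbb{C}$ $(n\in\Gamma)$, each of which is either the identity or complex conjugation, such that $$F(x)=\sum_{n\in\Gamma}\sigma_n(x(n))\,\Delta(e_n)\qquad\text{for all } x\in c_0(\Gamma),$$ where the sum converges unconditionally in the norm of $X$. In particular, $X$ is isometrically isomorphic to $c_0(\Gamma)$ as a complex Banach space. -/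

import Mathlib

open scoped ZeroAtInfty ComplexConjugate

/-!
For a set `Γ` with the discrete topology, `C₀(Γ, ℂ)` is the space of functions `x : Γ → ℂ` that
tend to zero along the cofinite filter, with the supremum norm, i.e. the complex space `c₀(Γ)`.
-/

/-- On a discrete space, a function vanishes at infinity exactly when, for every `ε > 0`,
only finitely many of its values have modulus at least `ε`. -/
theorem tendsto_cocompact_zero_iff_finite {Γ : Type*} [TopologicalSpace Γ] [DiscreteTopology Γ]
    (x : Γ → ℂ) :
    Filter.Tendsto x (Filter.cocompact Γ) (nhds 0) ↔
      ∀ ε : ℝ, 0 < ε → {n : Γ | ε ≤ ‖x n‖}.Finite := by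
  rw [Filter.cocompact_eq_cofinite, Metric.tendsto_nhds]
  simp only [Filter.eventually_cofinite, dist_zero_right, not_lt, gt_iff_lt]

/-- The vector `e_n` of the canonical basis of `c₀(Γ)`: it is `1` at `n` and `0` elsewhere. -/
noncomputable def c0Single {Γ : Type*} [TopologicalSpace Γ] [DiscreteTopology Γ] (n : Γ) :
    C₀(Γ, ℂ) where
  toFun := Set.indicator {n} (fun _ => (1 : ℂ))
  continuous_toFun := continuous_of_discreteTopology
  zero_at_infty' := by
    refine (tendsto_cocompact_zero_iff_finite _).2 fun ε hε => ?_
    refine (Set.finite_singleton n).subset fun m hm => ?_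
    by_contra h
    have h0 : Set.indicator {n} (fun _ => (1 : ℂ)) m = 0 := Set.indicator_of_notMem h _
    have hm' : ε ≤ ‖Set.indicator {n} (fun _ => (1 : ℂ)) m‖ := hm
    rw [h0, norm_zero] at hm'
    linarith

theorem c0Single_apply_self {Γ : Type*} [TopologicalSpace Γ] [DiscreteTopology Γ] (n : Γ) :
    c0Single n n = 1 := by
  change Set.indicator {n} (fun _ => (1 : ℂ)) n = 1
  exact Set.indicator_of_mem (Set.mem_singleton n) _

theorem c0Single_apply_of_ne {Γ : Type*} [TopologicalSpace Γ] [DiscreteTopology Γ] {n m : Γ}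
    (h : m ≠ n) : c0Single n m = 0 := by
  change Set.indicator {n} (fun _ => (1 : ℂ)) m = 0
  exact Set.indicator_of_notMem (s := {n}) h _

theorem norm_c0Single {Γ : Type*} [TopologicalSpace Γ] [DiscreteTopology Γ] (n : Γ) :
    ‖c0Single n‖ = 1 := by
  rw [← ZeroAtInftyContinuousMap.norm_toBCF_eq_norm]
  apply le_antisymm
  · refine (BoundedContinuousFunction.norm_le zero_le_one).2 fun m => ?_
    change ‖c0Single n m‖ ≤ 1
    by_cases h : m = n
    · rw [h, c0Single_apply_self, norm_one]
    · rw [c0Single_apply_of_ne h, norm_zero]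
      exact zero_le_one
  · have h := (c0Single n).toBCF.norm_coe_le_norm n
    change ‖c0Single n n‖ ≤ _ at h
    rwa [c0Single_apply_self, norm_one] at h

/-- `e_n` as a point of the unit sphere `S(c₀(Γ))`. -/
noncomputable def c0Basis {Γ : Type*} [TopologicalSpace Γ] [DiscreteTopology Γ] (n : Γ) :
    Metric.sphere (0 : C₀(Γ, ℂ)) 1 :=
  ⟨c0Single n, by rw [mem_sphere_zero_iff_norm, norm_c0Single]⟩

/-! The face of the sphere where `x n = z`, with `|z| = 1`, is metrically determined: it is the set
of points at distance two from `-z • e_n`. The crux (`one_le_norm_of_mem_convexHull`) is that the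
convex hull of its image stays outside the open unit ball of `X`. Given finitely many image points,
a nearby unit vector replaces `Δ (-z • e_n)`, chosen smooth inside the finite-dimensional span of
the data. Its norming functional is unique on that span, so a single functional is almost one at all
the given points.

Hahn–Banach then supplies a functional equal to one on the image of the face. A Lipschitz estimate
makes it behave like `x ↦ re (conj z * x n)`, which gives `IsCoordinateFunctional`. These
functionals norm `X` and detect the vanishing of coordinates, so `Δ` can be studied one coordinate
at a time.

On the circle through `e_n`, `Δ` preserves distances and its image is closed under unimodular
multiples of `Δ e_n` (`exists_map_c0Unit_eq_smul`). Hence it acts there as the identity or as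
conjugation. The resulting series defines a real-linear isometry, and the coordinate functionals
show that it agrees with `Δ` (`map_eq_of_hasSum`). -/

/-! ### Smooth points and supporting functionals -/

/-- Two norm-one functionals norming a point of differentiability of the norm coincide. -/
theorem eq_of_norming_of_differentiableAt_norm {E : Type*} [NormedAddCommGroup E]
    [NormedSpace ℝ E] {u : E} (hu : DifferentiableAt ℝ (‖·‖) u) {f : E →L[ℝ] ℝ}
    (hf : ∀ v, f v ≤ ‖v‖) (hfu : f u = ‖u‖) : f = fderiv ℝ (‖·‖) u := by
  have hmin : IsLocalMin (fun v => ‖v‖ - f v) u :=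
    Filter.Eventually.of_forall fun v => by
      have := hf v
      simp only [hfu, sub_self]
      linarith
  have h := hmin.hasFDerivAt_eq_zero (hu.hasFDerivAt.sub f.hasFDerivAt)
  exact (sub_eq_zero.1 h).symm

/-- Unit vectors which are smooth relative to a finite-dimensional subspace are dense in the unit
sphere of that subspace. -/
theorem exists_smooth_near {E : Type*} [NormedAddCommGroup E] [NormedSpace ℝ E]
    (V : Submodule ℝ E) [FiniteDimensional ℝ V] {w : E} (hw : w ∈ V) (hw1 : ‖w‖ = 1)
    {ε : ℝ} (hε : 0 < ε) :
    ∃ u : E, ‖u‖ = 1 ∧ ‖u - w‖ < ε ∧ ∀ f g : E →L[ℝ] ℝ, (∀ v, f v ≤ ‖v‖) → (∀ v, g v ≤ ‖v‖) →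
      f u = 1 → g u = 1 → ∀ v ∈ V, f v = g v := by
  -- Normalising moves the vector by at most its distance to `w`, hence `ε / 2`; the bound `1` keeps
  -- it nonzero.
  have hδ : 0 < min (ε / 2) 1 := by positivity
  obtain ⟨u, hu, hud⟩ := (dense_differentiableAt_norm (E := V)).exists_dist_lt ⟨w, hw⟩ hδ
  rw [dist_comm, dist_eq_norm] at hud
  have hud' : ‖(u : E) - w‖ < min (ε / 2) 1 := by simpa using hud
  have h1 : ‖(u : E) - w‖ < ε / 2 := hud'.trans_le (min_le_left _ _)
  have h2 : ‖(u : E) - w‖ < 1 := hud'.trans_le (min_le_right _ _)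
  have hn : |‖(u : E)‖ - 1| ≤ ‖(u : E) - w‖ := by rw [← hw1]; exact abs_norm_sub_norm_le _ _
  have hpos : 0 < ‖(u : E)‖ := by
    have := (abs_le.1 hn).1
    linarith
  refine ⟨‖(u : E)‖⁻¹ • (u : E), ?_, ?_, ?_⟩
  · rw [norm_smul, norm_inv, norm_norm, inv_mul_cancel₀ hpos.ne']
  · have h3 : ‖‖(u : E)‖⁻¹ • (u : E) - u‖ ≤ ‖(u : E) - w‖ := by
      have : ‖(u : E)‖⁻¹ • (u : E) - u = (‖(u : E)‖⁻¹ - 1) • (u : E) := by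
        rw [sub_smul, one_smul]
      rw [this, norm_smul, Real.norm_eq_abs]
      calc |‖(u : E)‖⁻¹ - 1| * ‖(u : E)‖ = |(‖(u : E)‖⁻¹ - 1) * ‖(u : E)‖| := by
            rw [abs_mul, abs_norm]
        _ = |‖(u : E)‖ - 1| := by
            rw [sub_mul, inv_mul_cancel₀ hpos.ne', one_mul, abs_sub_comm]
        _ ≤ _ := hn
    have := norm_sub_le_norm_sub_add_norm_sub (‖(u : E)‖⁻¹ • (u : E)) u w
    linarith
  · intro f g hf hg hfu hgu v hv
    have key : ∀ h : E →L[ℝ] ℝ, (∀ v, h v ≤ ‖v‖) → h (‖(u : E)‖⁻¹ • (u : E)) = 1 →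
        h.comp V.subtypeL = fderiv ℝ (‖·‖) u := fun h hh hhu =>
      eq_of_norming_of_differentiableAt_norm hu (fun v => hh v) (by
        rw [map_smul, smul_eq_mul, inv_mul_eq_one₀ hpos.ne'] at hhu
        exact hhu.symm)
    exact congrArg (fun k : V →L[ℝ] ℝ => k ⟨v, hv⟩) ((key f hf hfu).trans (key g hg hgu).symm)

theorem exists_norming_functional {E : Type*} [NormedAddCommGroup E] [NormedSpace ℝ E] (x : E) :
    ∃ f : E →L[ℝ] ℝ, (∀ v, f v ≤ ‖v‖) ∧ f x = ‖x‖ := by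
  obtain ⟨f, hf, hfx⟩ := exists_dual_vector'' ℝ x
  exact ⟨f, fun v => (le_abs_self _).trans (f.le_of_opNorm_le hf v |>.trans_eq (one_mul _)), hfx⟩

/-- A convex set in the complement of the open unit ball lies above level one of some
functional of norm at most one. -/
theorem exists_functional_one_le {E : Type*} [NormedAddCommGroup E] [NormedSpace ℝ E] {s : Set E}
    (hs : Convex ℝ s) (h : ∀ x ∈ s, 1 ≤ ‖x‖) :
    ∃ f : E →L[ℝ] ℝ, (∀ v, f v ≤ ‖v‖) ∧ ∀ x ∈ s, 1 ≤ f x := by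
  obtain ⟨f, c, hfb, hfs⟩ := geometric_hahn_banach_open (convex_ball (0 : E) 1)
    Metric.isOpen_ball hs (Set.disjoint_left.2 fun x hx hxs => by
      have := h x hxs
      rw [mem_ball_zero_iff] at hx
      linarith)
  have hc : 0 < c := by simpa using hfb 0 (Metric.mem_ball_self one_pos)
  refine ⟨c⁻¹ • f, fun v => ?_, fun x hx => ?_⟩
  · have hv : f v ≤ c * ‖v‖ := by
      refine le_of_forall_pos_le_add fun ε hε => ?_
      -- Dividing `v` by slightly more than its norm puts it in the open ball, and also covers `v =
      -- 0`.
      have hpos : 0 < ‖v‖ + ε / c := by positivity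
      have := hfb ((‖v‖ + ε / c)⁻¹ • v) (by
        rw [mem_ball_zero_iff, norm_smul, norm_inv, Real.norm_of_nonneg hpos.le,
          inv_mul_lt_one₀ hpos]
        have : 0 < ε / c := by positivity
        linarith)
      rw [map_smul, smul_eq_mul, inv_mul_lt_iff₀ hpos] at this
      have e : (‖v‖ + ε / c) * c = c * ‖v‖ + ε := by field_simp
      linarith
    rw [smul_apply, smul_eq_mul, inv_mul_le_iff₀ hc]
    exact hv
  · rw [smul_apply, smul_eq_mul, le_inv_mul_iff₀ hc, mul_one]
    exact hfs x hx

/-! ### Coordinates and norms in `c₀(Γ)` -/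

theorem c0_norm_apply_le {Γ : Type*} [TopologicalSpace Γ] (x : C₀(Γ, ℂ)) (n : Γ) : ‖x n‖ ≤ ‖x‖ :=
  x.toBCF.norm_coe_le_norm n

theorem c0_norm_le {Γ : Type*} [TopologicalSpace Γ] {x : C₀(Γ, ℂ)} {C : ℝ} (hC : 0 ≤ C)
    (h : ∀ n, ‖x n‖ ≤ C) : ‖x‖ ≤ C := by
  rw [← ZeroAtInftyContinuousMap.norm_toBCF_eq_norm]
  exact (BoundedContinuousFunction.norm_le hC).2 h

section C0

variable {Γ : Type*} [TopologicalSpace Γ] [DiscreteTopology Γ]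

/-- Only finitely many coordinates have modulus at least half the norm, so the supremum is a
maximum. -/
theorem c0_exists_norm_apply_eq {x : C₀(Γ, ℂ)} (hx : x ≠ 0) : ∃ n, ‖x n‖ = ‖x‖ := by
  have hpos : 0 < ‖x‖ := norm_pos_iff.2 hx
  have hfin : {n | ‖x‖ / 2 ≤ ‖x n‖}.Finite :=
    (tendsto_cocompact_zero_iff_finite x).1 x.zero_at_infty' _ (by positivity)
  have hne : {n | ‖x‖ / 2 ≤ ‖x n‖}.Nonempty := by
    by_contra hcon
    have : ‖x‖ ≤ ‖x‖ / 2 := c0_norm_le (by positivity) fun n => by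
      by_contra hn
      exact hcon ⟨n, (not_le.1 hn).le⟩
    linarith
  obtain ⟨n, hn, hmax⟩ := hfin.exists_maximalFor (fun n => ‖x n‖) _ hne
  refine ⟨n, le_antisymm (c0_norm_apply_le x n) (c0_norm_le (norm_nonneg _) fun m => ?_)⟩
  by_cases hm : ‖x‖ / 2 ≤ ‖x m‖
  · exact (le_total ‖x m‖ ‖x n‖).elim id fun h => hmax hm h
  · exact (not_le.1 hm).le.trans hn

open Classical in
theorem c0Single_apply (n m : Γ) : c0Single n m = if m = n then 1 else 0 := by
  split_ifs with h
  · rw [h, c0Single_apply_self]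
  · exact c0Single_apply_of_ne h

/-- Replace the value of `x` at `n` by `z`. -/
noncomputable def c0Update (x : C₀(Γ, ℂ)) (n : Γ) (z : ℂ) : C₀(Γ, ℂ) :=
  x + (z - x n) • c0Single n

theorem c0Update_self (x : C₀(Γ, ℂ)) (n : Γ) (z : ℂ) : c0Update x n z n = z := by
  simp [c0Update, c0Single_apply]

theorem c0Update_of_ne (x : C₀(Γ, ℂ)) {n m : Γ} (h : m ≠ n) (z : ℂ) :
    c0Update x n z m = x m := by
  simp [c0Update, c0Single_apply, h]

theorem norm_c0Update_sub (x : C₀(Γ, ℂ)) (n : Γ) (z : ℂ) : ‖c0Update x n z - x‖ = ‖z - x n‖ := by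
  simp [c0Update, norm_smul, norm_c0Single]

theorem norm_c0Update (x : C₀(Γ, ℂ)) (hx : ‖x‖ ≤ 1) (n : Γ) {z : ℂ} (hz : ‖z‖ = 1) :
    ‖c0Update x n z‖ = 1 := by
  refine le_antisymm (c0_norm_le zero_le_one fun m => ?_) ?_
  · by_cases h : m = n
    · rw [h, c0Update_self, hz]
    · rw [c0Update_of_ne x h]
      exact (c0_norm_apply_le x m).trans hx
  · rw [← hz]
    simpa only [c0Update_self] using c0_norm_apply_le (c0Update x n z) n

theorem norm_smul_c0Single (z : ℂ) (n : Γ) : ‖z • c0Single n‖ = ‖z‖ := by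
  rw [norm_smul, norm_c0Single, mul_one]

theorem smul_c0Single_apply_self (z : ℂ) (n : Γ) : (z • c0Single n) n = z := by
  simp [c0Single_apply]

theorem smul_c0Single_apply_of_ne (z : ℂ) {n m : Γ} (h : m ≠ n) : (z • c0Single n) m = 0 := by
  simp [c0Single_apply, h]

end C0

theorem norm_coe_sphere {E : Type*} [SeminormedAddCommGroup E] (x : Metric.sphere (0 : E) 1) :
    ‖(x : E)‖ = 1 := mem_sphere_zero_iff_norm.1 x.2

theorem norm_sub_of_sphere_isometry {E X : Type*} [SeminormedAddCommGroup E]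
    [SeminormedAddCommGroup X] {Δ : Metric.sphere (0 : E) 1 → Metric.sphere (0 : X) 1}
    (hΔ : Isometry Δ) (x y : Metric.sphere (0 : E) 1) :
    ‖(Δ x : X) - Δ y‖ = ‖(x : E) - y‖ := by
  simpa only [Subtype.dist_eq, dist_eq_norm] using hΔ.dist_eq x y

theorem exists_sphere_preimage {E X : Type*} [SeminormedAddCommGroup E]
    [SeminormedAddCommGroup X] {Δ : Metric.sphere (0 : E) 1 → Metric.sphere (0 : X) 1}
    (hsurj : Function.Surjective Δ) {y : X} (hy : ‖y‖ = 1) : ∃ x, (Δ x : X) = y := by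
  obtain ⟨x, hx⟩ := hsurj ⟨y, mem_sphere_zero_iff_norm.2 hy⟩
  exact ⟨x, by rw [hx]⟩

/-! ### Images of the faces of the sphere -/

section Faces

variable {Γ : Type*} [TopologicalSpace Γ] [DiscreteTopology Γ]
  {X : Type*} [NormedAddCommGroup X] [NormedSpace ℂ X]
  {Δ : Metric.sphere (0 : C₀(Γ, ℂ)) 1 → Metric.sphere (0 : X) 1}

/-- The vector `z • e_n`, `|z| = 1`, as a point of the unit sphere. -/
noncomputable def c0Unit (n : Γ) (z : ℂ) (hz : ‖z‖ = 1) : Metric.sphere (0 : C₀(Γ, ℂ)) 1 :=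
  ⟨z • c0Single n, by rw [mem_sphere_zero_iff_norm, norm_smul_c0Single, hz]⟩

theorem eq_of_norm_add_eq_two {z w : ℂ} (hz : ‖z‖ ≤ 1) (hw : ‖w‖ = 1) (h : ‖z + w‖ = 2) :
    z = w := by
  have h1 := parallelogram_law_with_norm ℝ z w
  rw [h, hw] at h1
  have h2 : ‖z - w‖ = 0 := by
    have := norm_nonneg z
    nlinarith [norm_nonneg (z - w)]
  exact sub_eq_zero.1 (norm_eq_zero.1 h2)

/-- The face `{x n = z}` of the sphere is the set of points at distance two from `-z • e_n`. -/
theorem norm_sub_c0Unit_neg_eq_two_iff {n : Γ} {z : ℂ} (hz : ‖z‖ = 1) (hz' : ‖-z‖ = 1)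
    (x : Metric.sphere (0 : C₀(Γ, ℂ)) 1) :
    ‖(x : C₀(Γ, ℂ)) - (c0Unit n (-z) hz' : C₀(Γ, ℂ))‖ = 2 ↔ (x : C₀(Γ, ℂ)) n = z := by
  constructor
  · intro h
    have h0 : (x : C₀(Γ, ℂ)) - (c0Unit n (-z) hz' : C₀(Γ, ℂ)) ≠ 0 := by
      intro h0
      rw [h0, norm_zero] at h
      norm_num at h
    obtain ⟨m, hm⟩ := c0_exists_norm_apply_eq h0
    have hx := c0_norm_apply_le (x : C₀(Γ, ℂ))
    simp only [norm_coe_sphere] at hx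
    rw [h, ZeroAtInftyContinuousMap.sub_apply] at hm
    by_cases hmn : m = n
    · subst hmn
      refine eq_of_norm_add_eq_two (hx m) hz ?_
      simpa only [c0Unit, smul_c0Single_apply_self, sub_neg_eq_add] using hm
    · have := hx m
      simp only [c0Unit, smul_c0Single_apply_of_ne _ hmn, sub_zero] at hm
      linarith
  · intro h
    refine le_antisymm ((norm_sub_le _ _).trans_eq ?_) ?_
    · rw [norm_coe_sphere, norm_coe_sphere]
      norm_num
    · refine le_trans (Eq.ge ?_) (c0_norm_apply_le _ n)
      rw [ZeroAtInftyContinuousMap.sub_apply, h]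
      simp only [c0Unit, smul_c0Single_apply_self, sub_neg_eq_add]
      rw [← two_mul, norm_mul, hz]
      norm_num

/-- A coordinate of modulus one away from `n` would by itself put `v` at distance at least one from
`z • e_n`. -/
theorem norm_apply_eq_one_of_near {n : Γ} {z : ℂ} (hz : ‖z‖ = 1)
    (v : Metric.sphere (0 : C₀(Γ, ℂ)) 1)
    (h : ‖(v : C₀(Γ, ℂ)) - (c0Unit n z hz : C₀(Γ, ℂ))‖ < 1) : ‖(v : C₀(Γ, ℂ)) n‖ = 1 := by
  obtain ⟨m, hm⟩ := c0_exists_norm_apply_eq (x := (v : C₀(Γ, ℂ))) (by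
    rw [← norm_ne_zero_iff, norm_coe_sphere]
    norm_num)
  rw [norm_coe_sphere] at hm
  by_cases hmn : m = n
  · rwa [hmn] at hm
  · have := c0_norm_apply_le ((v : C₀(Γ, ℂ)) - (c0Unit n z hz : C₀(Γ, ℂ))) m
    simp only [ZeroAtInftyContinuousMap.sub_apply, c0Unit, smul_c0Single_apply_of_ne _ hmn,
      sub_zero, hm] at this
    simp only [c0Unit] at h
    linarith

/-- The image of the face `{x n = z}` has convex hull outside the open unit ball. -/
theorem one_le_norm_of_mem_convexHull (hΔ : Isometry Δ) (hsurj : Function.Surjective Δ)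
    {n : Γ} {z : ℂ} (hz : ‖z‖ = 1) {p : X}
    (hp : p ∈ convexHull ℝ {y : X | ∃ x : Metric.sphere (0 : C₀(Γ, ℂ)) 1,
      (x : C₀(Γ, ℂ)) n = z ∧ (Δ x : X) = y}) : 1 ≤ ‖p‖ := by
  have hz' : ‖-z‖ = 1 := by rwa [norm_neg]
  rw [convexHull_eq_union_convexHull_finite_subsets] at hp
  simp only [Set.mem_iUnion] at hp
  obtain ⟨t, hts, hp⟩ := hp
  refine le_of_forall_pos_le_add fun ε hε => ?_
  set w : X := (Δ (c0Unit n (-z) hz') : X) with hw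
  -- `V` contains `w`, near which a smooth point is sought, and `t`, on which functionals will be
  -- compared.
  let V : Submodule ℝ X := Submodule.span ℝ (insert w (t : Set X))
  have : FiniteDimensional ℝ V :=
    FiniteDimensional.span_of_finite ℝ (t.finite_toSet.insert w)
  obtain ⟨u, hu1, huw, huniq⟩ := exists_smooth_near V
    (Submodule.subset_span (Set.mem_insert w _)) (norm_coe_sphere _) (lt_min hε one_pos)
  obtain ⟨v, hv⟩ := exists_sphere_preimage hsurj hu1
  have hvd : ‖(v : C₀(Γ, ℂ)) - (c0Unit n (-z) hz' : C₀(Γ, ℂ))‖ < min ε 1 := by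
    rwa [← norm_sub_of_sphere_isometry hΔ, hv]
  have hvn := norm_apply_eq_one_of_near hz' v (hvd.trans_le (min_le_right _ _))
  have hvn' : ‖-(v : C₀(Γ, ℂ)) n‖ = 1 := by rwa [norm_neg]
  have hvz : ‖-(v : C₀(Γ, ℂ)) n - z‖ < ε := by
    have := c0_norm_apply_le ((v : C₀(Γ, ℂ)) - (c0Unit n (-z) hz' : C₀(Γ, ℂ))) n
    simp only [ZeroAtInftyContinuousMap.sub_apply] at this
    rw [show (c0Unit n (-z) hz' : C₀(Γ, ℂ)) n = -z from smul_c0Single_apply_self _ _,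
      ← norm_neg, neg_sub', neg_neg] at this
    exact this.trans_lt (hvd.trans_le (min_le_left _ _))
  -- `h` is fixed before any point of `t` is chosen; one functional has to serve them all.
  obtain ⟨h, hh, hhu⟩ := exists_norming_functional (-u)
  rw [norm_neg, hu1] at hhu
  have hlow : ∀ y ∈ t, 1 - ε ≤ h y := by
    intro y hy
    obtain ⟨x, hxn, rfl⟩ := hts hy
    -- Changing the coordinate `n` of `x` to `-v n` costs less than `ε` and makes the new point
    -- exactly opposite to `v` at `n`, hence at distance two.
    have hxd := norm_c0Update_sub (x : C₀(Γ, ℂ)) n (-(v : C₀(Γ, ℂ)) n)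
    let x' : Metric.sphere (0 : C₀(Γ, ℂ)) 1 := ⟨c0Update x n (-(v : C₀(Γ, ℂ)) n),
      mem_sphere_zero_iff_norm.2 (norm_c0Update _ (norm_coe_sphere x).le n hvn')⟩
    have hx'n : (x' : C₀(Γ, ℂ)) n = -(v : C₀(Γ, ℂ)) n := c0Update_self _ _ _
    have hdist : ‖(Δ x' : X) - u‖ = 2 := by
      rw [← hv, norm_sub_of_sphere_isometry hΔ]
      refine le_antisymm ((norm_sub_le _ _).trans_eq ?_) ?_
      · rw [norm_coe_sphere, norm_coe_sphere]
        norm_num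
      · refine le_trans (Eq.ge ?_) (c0_norm_apply_le _ n)
        rw [ZeroAtInftyContinuousMap.sub_apply, hx'n, ← neg_add', norm_neg, ← two_mul, norm_mul,
          hvn]
        norm_num
    have hnear : ‖(Δ x' : X) - Δ x‖ < ε := by
      rw [norm_sub_of_sphere_isometry hΔ]
      refine lt_of_eq_of_lt hxd ?_
      rwa [hxn]
    obtain ⟨g, hg, hgx⟩ := exists_norming_functional ((Δ x' : X) - u)
    rw [hdist, map_sub] at hgx
    have h1 := hg (Δ x' : X)
    have h2 := hg (-u)
    rw [norm_coe_sphere] at h1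
    rw [norm_neg, hu1, map_neg] at h2
    -- Distance two forces `g (-u) = 1`. Smoothness is known at `u`, so it is applied to the
    -- negatives.
    have hgh : ∀ a ∈ V, (-g) a = (-h) a := by
      refine huniq (-g) (-h) (fun a => ?_) (fun a => ?_) ?_ ?_
      · simpa using hg (-a)
      · simpa using hh (-a)
      · rw [neg_apply]
        linarith
      · simpa using hhu
    have h3 := hgh _ (Submodule.subset_span (Set.mem_insert_of_mem w hy))
    rw [neg_apply, neg_apply, neg_inj] at h3
    have h4 := hg ((Δ x' : X) - Δ x)
    rw [map_sub] at h4
    rw [← h3]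
    linarith
  have hconv : Convex ℝ {y : X | 1 - ε ≤ h y} :=
    convex_halfSpace_ge h.toLinearMap.isLinear (1 - ε)
  have h5 : 1 - ε ≤ h p := convexHull_min (fun y hy => hlow y hy) hconv hp
  have h6 := hh p
  linarith

/-- The image of the face `{x n = z}` is the intersection of the sphere with a supporting
hyperplane. -/
theorem exists_support_functional (hΔ : Isometry Δ) (hsurj : Function.Surjective Δ)
    (n : Γ) {z : ℂ} (hz : ‖z‖ = 1) :
    ∃ f : X →L[ℝ] ℝ, (∀ v, f v ≤ ‖v‖) ∧
      ∀ x : Metric.sphere (0 : C₀(Γ, ℂ)) 1, (x : C₀(Γ, ℂ)) n = z → f (Δ x) = 1 := by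
  obtain ⟨f, hf, hf1⟩ := exists_functional_one_le (convex_convexHull ℝ _)
    fun p hp => one_le_norm_of_mem_convexHull hΔ hsurj (n := n) hz hp
  refine ⟨f, hf, fun x hx => le_antisymm ((hf _).trans_eq (norm_coe_sphere _)) ?_⟩
  exact hf1 _ (subset_convexHull ℝ _ ⟨x, hx, rfl⟩)

/-- The antipode of a point in the image of `{x n = z}` lies in the image of `{x n = -z}`. -/
theorem apply_eq_neg_of_neg (hΔ : Isometry Δ) (hsurj : Function.Surjective Δ)
    {n : Γ} {z : ℂ} (hz : ‖z‖ = 1) {x x' : Metric.sphere (0 : C₀(Γ, ℂ)) 1}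
    (hx : (x : C₀(Γ, ℂ)) n = z) (hxx' : (Δ x' : X) = -Δ x) : (x' : C₀(Γ, ℂ)) n = -z := by
  have hz' : ‖-z‖ = 1 := by rwa [norm_neg]
  have hz'' : ‖- -z‖ = 1 := by rwa [neg_neg]
  obtain ⟨f, hf, hf1⟩ := exists_support_functional hΔ hsurj n hz
  rw [← norm_sub_c0Unit_neg_eq_two_iff hz' hz'', ← norm_sub_of_sphere_isometry hΔ]
  refine le_antisymm ((norm_sub_le _ _).trans_eq ?_) ?_
  · rw [norm_coe_sphere, norm_coe_sphere]
    norm_num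
  -- The support functional is one at both `Δ x` and `Δ (z • e_n)`, so their sum has norm at least
  -- two.
  · rw [hxx', ← norm_neg, neg_sub', neg_neg, sub_neg_eq_add]
    refine le_trans (Eq.ge ?_) (hf _)
    rw [map_add, hf1 x hx, hf1 (c0Unit n (- -z) hz'')
      ((smul_c0Single_apply_self _ _).trans (neg_neg z))]
    norm_num

/-! ### Coordinate functionals -/

variable (Δ) in
/-- A functional `f` on the target space which plays the role of `x ↦ re (conj z * x n)`: it has
norm at most one, and `f (Δ x)` is controlled by `x n`. -/
structure IsCoordinateFunctional (n : Γ) (z : ℂ) (f : X →L[ℝ] ℝ) : Prop where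
  abs_le_norm : ∀ v, |f v| ≤ ‖v‖
  abs_apply_le : ∀ x : Metric.sphere (0 : C₀(Γ, ℂ)) 1, |f (Δ x)| ≤ ‖(x : C₀(Γ, ℂ)) n‖
  apply_eq : ∀ (x : Metric.sphere (0 : C₀(Γ, ℂ)) 1) (t : ℝ), |t| ≤ 1 →
    (x : C₀(Γ, ℂ)) n = t * z → f (Δ x) = t

/-- The support functional of the face at `z` is `1` there and, by antipodes, `-1` on the face at
`-z`. Moving `x n` to `z` or `-z` yields `1 - |z - x n| ≤ f (Δ x) ≤ |z + x n| - 1`; both bounds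
equal `t` when `x n = t * z`. -/
theorem exists_isCoordinateFunctional (hΔ : Isometry Δ) (hsurj : Function.Surjective Δ)
    (n : Γ) {z : ℂ} (hz : ‖z‖ = 1) : ∃ f : X →L[ℝ] ℝ, IsCoordinateFunctional Δ n z f := by
  have hz' : ‖-z‖ = 1 := by rwa [norm_neg]
  obtain ⟨f, hf, hf1⟩ := exists_support_functional hΔ hsurj n hz
  have hfn : ∀ x : Metric.sphere (0 : C₀(Γ, ℂ)) 1, (x : C₀(Γ, ℂ)) n = -z → f (Δ x) = -1 := by
    intro x hx
    obtain ⟨x', hx'⟩ := exists_sphere_preimage hsurj (y := -(Δ x : X))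
      (by rw [norm_neg, norm_coe_sphere])
    have h1 := apply_eq_neg_of_neg hΔ hsurj hz' hx hx'
    have h2 := hf1 x' (by rw [h1, neg_neg])
    rw [hx', map_neg] at h2
    linarith
  let up (x : Metric.sphere (0 : C₀(Γ, ℂ)) 1) (a : ℂ) (ha : ‖a‖ = 1) :
      Metric.sphere (0 : C₀(Γ, ℂ)) 1 :=
    ⟨c0Update x n a, mem_sphere_zero_iff_norm.2 (norm_c0Update _ (norm_coe_sphere x).le n ha)⟩
  have hup : ∀ (x : Metric.sphere (0 : C₀(Γ, ℂ)) 1) a ha,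
      ‖(Δ (up x a ha) : X) - Δ x‖ = ‖a - (x : C₀(Γ, ℂ)) n‖ := fun x a ha => by
    rw [norm_sub_of_sphere_isometry hΔ]
    exact norm_c0Update_sub _ _ _
  have hlow : ∀ x : Metric.sphere (0 : C₀(Γ, ℂ)) 1,
      1 - ‖z - (x : C₀(Γ, ℂ)) n‖ ≤ f (Δ x) := fun x => by
    have h1 := hf ((Δ (up x z hz) : X) - Δ x)
    rw [hup x z hz, map_sub, hf1 (up x z hz) (c0Update_self (x : C₀(Γ, ℂ)) n z)] at h1
    linarith
  have hupp : ∀ x : Metric.sphere (0 : C₀(Γ, ℂ)) 1,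
      f (Δ x) ≤ -1 + ‖z + (x : C₀(Γ, ℂ)) n‖ := fun x => by
    have h1 := hf (-((Δ (up x (-z) hz') : X) - Δ x))
    rw [norm_neg, hup x (-z) hz', map_neg, map_sub, hfn (up x (-z) hz') (c0Update_self _ _ _),
      ← neg_add' z, norm_neg] at h1
    linarith
  refine ⟨f, fun v => abs_le.2 ⟨?_, hf v⟩, fun x => abs_le.2 ⟨?_, ?_⟩, fun x t ht hx => ?_⟩
  · have := hf (-v)
    rw [map_neg, norm_neg] at this
    linarith
  · have := norm_sub_le z ((x : C₀(Γ, ℂ)) n)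
    have := hlow x
    linarith
  · have := norm_add_le z ((x : C₀(Γ, ℂ)) n)
    have := hupp x
    linarith
  · obtain ⟨h1, h2⟩ := abs_le.1 ht
    have e1 : ‖z - (x : C₀(Γ, ℂ)) n‖ = 1 - t := by
      rw [hx, show z - t * z = ((1 - t : ℝ) : ℂ) * z by push_cast; ring, norm_mul, hz, mul_one,
        Complex.norm_of_nonneg (by linarith)]
    have e2 : ‖z + (x : C₀(Γ, ℂ)) n‖ = 1 + t := by
      rw [hx, show z + t * z = ((1 + t : ℝ) : ℂ) * z by push_cast; ring, norm_mul, hz, mul_one,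
        Complex.norm_of_nonneg (by linarith)]
    have h3 := hlow x
    have h4 := hupp x
    rw [e1] at h3
    rw [e2] at h4
    linarith

end Faces

/-! ### Plane geometry of the unit circle -/

theorem Complex.eq_mul_I_or_of_norm_sub {p z : ℂ} (hz : ‖z‖ = 1) (h1 : ‖p - z‖ ^ 2 = 2)
    (h2 : ‖p + z‖ ^ 2 = 2) : p = Complex.I * z ∨ p = -(Complex.I * z) := by
  have hzz : conj z * z = 1 := by rw [mul_comm, Complex.mul_conj', hz]; norm_num
  have hq : p = p * conj z * z := by rw [mul_assoc, hzz, mul_one]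
  have hc : ‖conj z‖ = 1 := by rwa [Complex.norm_conj]
  have e1 : ‖p - z‖ = ‖p * conj z - 1‖ := by
    rw [← mul_one ‖p - z‖, ← hc, ← norm_mul, sub_mul, mul_comm z, hzz]
  have e2 : ‖p + z‖ = ‖p * conj z + 1‖ := by
    rw [← mul_one ‖p + z‖, ← hc, ← norm_mul, add_mul, mul_comm z, hzz]
  rw [e1, ← Complex.normSq_eq_norm_sq, Complex.normSq_apply] at h1
  rw [e2, ← Complex.normSq_eq_norm_sq, Complex.normSq_apply] at h2
  generalize p * conj z = q at *
  simp only [Complex.sub_re, Complex.sub_im, Complex.one_re, Complex.one_im, Complex.add_re,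
    Complex.add_im] at h1 h2
  have hre : q.re = 0 := by linarith
  rw [hre] at h1
  have him : (q.im - 1) * (q.im + 1) = 0 := by linarith
  rcases mul_eq_zero.1 him with h | h
  · left
    rw [hq, show q = Complex.I from Complex.ext (by simpa using hre)
      (by simpa using sub_eq_zero.1 h)]
  · right
    rw [hq, show q = -Complex.I from Complex.ext (by simpa using hre)
      (by simpa using eq_neg_of_add_eq_zero_left h), neg_mul]

/-- On the unit circle the distances to `1` and `I` determine the real and imaginary parts. -/
theorem Complex.eq_of_norm_sub_one_of_norm_sub_I {a b : ℂ} (ha : ‖a‖ = 1) (hb : ‖b‖ = 1)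
    (h1 : ‖a - 1‖ = ‖b - 1‖) (hI : ‖a - Complex.I‖ = ‖b - Complex.I‖) : a = b := by
  have ha' := Complex.normSq_eq_norm_sq a
  have hb' := Complex.normSq_eq_norm_sq b
  have h1' : Complex.normSq (a - 1) = Complex.normSq (b - 1) := by
    rw [Complex.normSq_eq_norm_sq, h1, Complex.normSq_eq_norm_sq]
  have hI' : Complex.normSq (a - Complex.I) = Complex.normSq (b - Complex.I) := by
    rw [Complex.normSq_eq_norm_sq, hI, Complex.normSq_eq_norm_sq]
  rw [ha] at ha'
  rw [hb] at hb'
  simp only [Complex.normSq_apply, Complex.sub_re, Complex.sub_im, Complex.one_re,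
    Complex.one_im, Complex.I_re, Complex.I_im] at *
  apply Complex.ext <;> linarith

/-- A real functional of norm at most one on `ℂ` with value one at the unimodular number `z`. -/
theorem Complex.functional_eq_re_conj_mul (g : ℂ →ₗ[ℝ] ℝ) (hg : ∀ w, g w ≤ ‖w‖) {z : ℂ}
    (hz : ‖z‖ = 1) (hgz : g z = 1) (w : ℂ) : g w = (conj z * w).re := by
  have hlin : ∀ a b : ℝ, g ((a + b * Complex.I) * z) = a + b * g (Complex.I * z) := by
    intro a b
    have : (a + b * Complex.I) * z = a • z + b • (Complex.I * z) := by
      simp only [Complex.real_smul]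
      ring
    rw [this, map_add, map_smul, map_smul, hgz, smul_eq_mul, smul_eq_mul, mul_one]
  -- With `θ = g (I * z)`, testing `g` on `(1 + θ * I) * z` gives `1 + θ² ≤ √(1 + θ²)`, so `θ = 0`.
  have h0 : g (Complex.I * z) = 0 := by
    have h1 := hlin 1 (g (Complex.I * z))
    have h2 := hg (((1 : ℝ) + g (Complex.I * z) * Complex.I) * z)
    rw [h1, norm_mul, hz, mul_one] at h2
    have h3 := Complex.normSq_eq_norm_sq ((1 : ℝ) + g (Complex.I * z) * Complex.I)
    rw [Complex.normSq_add_mul_I] at h3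
    generalize g (Complex.I * z) = θ at *
    have h4 : (1 + θ * θ) ^ 2 ≤ 1 ^ 2 + θ ^ 2 := by
      rw [h3]
      exact pow_le_pow_left₀ (by nlinarith [mul_self_nonneg θ]) h2 2
    have h5 : θ ^ 2 ≤ 0 := by nlinarith [sq_nonneg (θ * θ)]
    exact pow_eq_zero_iff two_ne_zero |>.1 (le_antisymm h5 (sq_nonneg θ))
  have hw : w = ((conj z * w).re + (conj z * w).im * Complex.I) * z := by
    rw [Complex.re_add_im, mul_right_comm, mul_comm (conj z), Complex.mul_conj', hz]
    norm_num
  conv_lhs => rw [hw]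
  rw [hlin, h0, mul_zero, add_zero]

theorem Complex.exists_phase {w : ℂ} (hw : w ≠ 0) : ∃ z : ℂ, ‖z‖ = 1 ∧ w = ‖w‖ * z := by
  have h : (‖w‖ : ℂ) ≠ 0 := by simpa using hw
  exact ⟨w / ‖w‖, by simp [hw], by field_simp⟩

/-! ### Action of the isometry on the circles through the basis vectors -/

section Coordinates

variable {Γ : Type*} [TopologicalSpace Γ] [DiscreteTopology Γ]
  {X : Type*} [NormedAddCommGroup X] [NormedSpace ℂ X]
  {Δ : Metric.sphere (0 : C₀(Γ, ℂ)) 1 → Metric.sphere (0 : X) 1}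

omit [DiscreteTopology Γ] in
theorem IsCoordinateFunctional.apply_of_eq_zero {n : Γ} {z : ℂ} {f : X →L[ℝ] ℝ}
    (hf : IsCoordinateFunctional Δ n z f) {x : Metric.sphere (0 : C₀(Γ, ℂ)) 1}
    (hx : (x : C₀(Γ, ℂ)) n = 0) : f (Δ x) = 0 := by
  have := hf.abs_apply_le x
  rw [hx, norm_zero] at this
  exact abs_eq_zero.1 (le_antisymm this (abs_nonneg _))

/-- At a point `Δ x` the modulus of `x n` is attained by a coordinate functional. -/
theorem exists_functional_apply_eq_norm (hΔ : Isometry Δ) (hsurj : Function.Surjective Δ)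
    (x : Metric.sphere (0 : C₀(Γ, ℂ)) 1) {n : Γ} (hx : (x : C₀(Γ, ℂ)) n ≠ 0) :
    ∃ (z : ℂ) (f : X →L[ℝ] ℝ), ‖z‖ = 1 ∧ IsCoordinateFunctional Δ n z f ∧
      (x : C₀(Γ, ℂ)) n = ‖(x : C₀(Γ, ℂ)) n‖ * z ∧ f (Δ x) = ‖(x : C₀(Γ, ℂ)) n‖ := by
  obtain ⟨z, hz, hxz⟩ := Complex.exists_phase hx
  obtain ⟨f, hf⟩ := exists_isCoordinateFunctional hΔ hsurj n hz
  refine ⟨z, f, hz, hf, hxz, hf.apply_eq x _ ?_ hxz⟩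
  rw [abs_norm]
  exact (c0_norm_apply_le _ _).trans_eq (norm_coe_sphere x)

/-- The preimage of the normalised `y` has a coordinate of modulus one; the functional with that
phase norms `y`. -/
theorem exists_functional_norming (hΔ : Isometry Δ) (hsurj : Function.Surjective Δ) {y : X}
    (hy : y ≠ 0) : ∃ (n : Γ) (z : ℂ) (f : X →L[ℝ] ℝ), ‖z‖ = 1 ∧ IsCoordinateFunctional Δ n z f ∧
      f y = ‖y‖ := by
  obtain ⟨x, hx⟩ := exists_sphere_preimage hsurj (y := ‖y‖⁻¹ • y) (by
    rw [norm_smul, norm_inv, norm_norm, inv_mul_cancel₀ (norm_ne_zero_iff.2 hy)])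
  have hx1 := norm_coe_sphere x
  obtain ⟨n, hn⟩ := c0_exists_norm_apply_eq (x := (x : C₀(Γ, ℂ))) (by
    rw [← norm_ne_zero_iff, hx1]
    norm_num)
  rw [hx1] at hn
  obtain ⟨z, f, hz, hf, -, hfx⟩ := exists_functional_apply_eq_norm hΔ hsurj x (n := n) (by
    rw [← norm_ne_zero_iff, hn]
    norm_num)
  refine ⟨n, z, f, hz, hf, ?_⟩
  rw [hx, hn, map_smul, smul_eq_mul, inv_mul_eq_one₀ (norm_ne_zero_iff.2 hy)] at hfx
  exact hfx.symm

theorem norm_le_of_functional_le (hΔ : Isometry Δ) (hsurj : Function.Surjective Δ) {y : X}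
    {C : ℝ} (hC : 0 ≤ C) (h : ∀ (n : Γ) (z : ℂ) (f : X →L[ℝ] ℝ), ‖z‖ = 1 →
      IsCoordinateFunctional Δ n z f → f y ≤ C) : ‖y‖ ≤ C := by
  by_cases hy : y = 0
  · rwa [hy, norm_zero]
  · obtain ⟨n, z, f, hz, hf, hfy⟩ := exists_functional_norming hΔ hsurj hy
    rw [← hfy]
    exact h n z f hz hf

theorem apply_eq_zero_of_functional_eq_zero (hΔ : Isometry Δ) (hsurj : Function.Surjective Δ)
    (x : Metric.sphere (0 : C₀(Γ, ℂ)) 1) {n : Γ}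
    (h : ∀ (z : ℂ) (f : X →L[ℝ] ℝ), ‖z‖ = 1 → IsCoordinateFunctional Δ n z f → f (Δ x) = 0) :
    (x : C₀(Γ, ℂ)) n = 0 := by
  by_contra hx
  obtain ⟨z, f, hz, hf, -, hfx⟩ := exists_functional_apply_eq_norm hΔ hsurj x hx
  rw [h z f hz hf] at hfx
  exact hx (norm_eq_zero.1 hfx.symm)

theorem c0Unit_apply_self (n : Γ) (z : ℂ) (hz : ‖z‖ = 1) :
    (c0Unit n z hz : C₀(Γ, ℂ)) n = z := smul_c0Single_apply_self z n

theorem c0Unit_apply_of_ne {n m : Γ} (z : ℂ) (hz : ‖z‖ = 1) (h : m ≠ n) :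
    (c0Unit n z hz : C₀(Γ, ℂ)) m = 0 := smul_c0Single_apply_of_ne z h

theorem eq_c0Unit {x : Metric.sphere (0 : C₀(Γ, ℂ)) 1} {n : Γ} {z : ℂ} (hz : ‖z‖ = 1)
    (hn : (x : C₀(Γ, ℂ)) n = z) (h : ∀ m, m ≠ n → (x : C₀(Γ, ℂ)) m = 0) : x = c0Unit n z hz := by
  refine Subtype.ext (ZeroAtInftyContinuousMap.ext fun m => ?_)
  by_cases hm : m = n
  · rw [hm, hn, c0Unit_apply_self]
  · rw [h m hm, c0Unit_apply_of_ne z hz hm]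

theorem norm_c0Unit_sub (n : Γ) {z w : ℂ} (hz : ‖z‖ = 1) (hw : ‖w‖ = 1) :
    ‖(c0Unit n z hz : C₀(Γ, ℂ)) - (c0Unit n w hw : C₀(Γ, ℂ))‖ = ‖z - w‖ := by
  rw [← norm_smul_c0Single (z - w) n]
  refine congrArg norm (ZeroAtInftyContinuousMap.ext fun m => ?_)
  exact (sub_mul z w (c0Single n m)).symm

theorem map_c0Unit_neg (hΔ : Isometry Δ) (hsurj : Function.Surjective Δ) (n : Γ) {z : ℂ}
    (hz : ‖z‖ = 1) (hz' : ‖-z‖ = 1) : (Δ (c0Unit n (-z) hz') : X) = -Δ (c0Unit n z hz) := by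
  obtain ⟨x, hx⟩ := exists_sphere_preimage hsurj (y := -(Δ (c0Unit n z hz) : X))
    (by rw [norm_neg, norm_coe_sphere])
  rw [← hx, eq_c0Unit hz' (apply_eq_neg_of_neg hΔ hsurj hz (c0Unit_apply_self n z hz) hx)]
  intro m hm
  refine apply_eq_zero_of_functional_eq_zero hΔ hsurj x fun w f _ hf => ?_
  rw [hx, map_neg, hf.apply_of_eq_zero (c0Unit_apply_of_ne z hz hm), neg_zero]

/-- Each coordinate functional kills at least one of the two summands. -/
theorem norm_map_c0Unit_add_le (hΔ : Isometry Δ) (hsurj : Function.Surjective Δ) {n m : Γ}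
    (hnm : n ≠ m) {z w : ℂ} (hz : ‖z‖ = 1) (hw : ‖w‖ = 1) :
    ‖(Δ (c0Unit n z hz) : X) + Δ (c0Unit m w hw)‖ ≤ 1 := by
  refine norm_le_of_functional_le hΔ hsurj zero_le_one fun k u f _ hf => ?_
  rw [map_add]
  have h1 := (le_abs_self _).trans ((hf.abs_le_norm _).trans_eq
    (norm_coe_sphere (Δ (c0Unit n z hz))))
  have h2 := (le_abs_self _).trans ((hf.abs_le_norm _).trans_eq
    (norm_coe_sphere (Δ (c0Unit m w hw))))
  by_cases hk : k = n
  · rw [hf.apply_of_eq_zero (c0Unit_apply_of_ne w hw (hk.trans_ne hnm))]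
    linarith
  · rw [hf.apply_of_eq_zero (c0Unit_apply_of_ne z hz hk)]
    linarith

/-- The points `x` and `±z • e_n` are at distance `√2 > 1`, which can only be attained at the
coordinate `n`. -/
theorem I_smul_preimage_apply (hΔ : Isometry Δ) (hsurj : Function.Surjective Δ) {n : Γ} {z : ℂ}
    (hz : ‖z‖ = 1) {x : Metric.sphere (0 : C₀(Γ, ℂ)) 1}
    (hx : (Δ x : X) = Complex.I • (Δ (c0Unit n z hz) : X)) :
    (x : C₀(Γ, ℂ)) n = Complex.I * z ∨ (x : C₀(Γ, ℂ)) n = -(Complex.I * z) := by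
  have hdist : ∀ (c : ℂ) (w : ℂ) (hw : ‖w‖ = 1), ‖c‖ ^ 2 = 2 →
      (Δ x : X) - Δ (c0Unit n w hw) = c • (Δ (c0Unit n z hz) : X) →
      ‖(x : C₀(Γ, ℂ)) n - w‖ ^ 2 = 2 := by
    intro c w hw hc hxw
    have h1 : ‖(x : C₀(Γ, ℂ)) - (c0Unit n w hw : C₀(Γ, ℂ))‖ = ‖c‖ := by
      rw [← norm_sub_of_sphere_isometry hΔ, hxw, norm_smul, norm_coe_sphere, mul_one]
    have hc1 : 1 < ‖c‖ := by
      by_contra hcon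
      have := norm_nonneg c
      nlinarith
    obtain ⟨m, hm⟩ := c0_exists_norm_apply_eq
      (x := (x : C₀(Γ, ℂ)) - (c0Unit n w hw : C₀(Γ, ℂ))) (by
        rw [← norm_ne_zero_iff, h1]
        linarith)
    rw [ZeroAtInftyContinuousMap.sub_apply, h1] at hm
    by_cases hmn : m = n
    · rw [hmn, c0Unit_apply_self] at hm
      rw [hm, hc]
    · rw [c0Unit_apply_of_ne w hw hmn, sub_zero] at hm
      have := (c0_norm_apply_le (x : C₀(Γ, ℂ)) m).trans_eq (norm_coe_sphere x)
      linarith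
  have hz' : ‖-z‖ = 1 := by rwa [norm_neg]
  refine Complex.eq_mul_I_or_of_norm_sub hz (hdist (Complex.I - 1) z hz ?_ ?_) ?_
  · rw [← Complex.normSq_eq_norm_sq, Complex.normSq_apply]
    norm_num
  · rw [hx, sub_smul, one_smul]
  · rw [← sub_neg_eq_add]
    refine hdist (Complex.I + 1) (-z) hz' ?_ ?_
    · rw [← Complex.normSq_eq_norm_sq, Complex.normSq_apply]
      norm_num
    · rw [hx, map_c0Unit_neg hΔ hsurj n hz, sub_neg_eq_add, add_smul, one_smul]

/-- On `I • Δ (I * w • e_m)` the functional is `±1`. Adding or subtracting this vector from `I • Δ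
(z • e_n)` keeps the norm at most one, so the value there must be zero. -/
theorem IsCoordinateFunctional.apply_I_smul (hΔ : Isometry Δ) (hsurj : Function.Surjective Δ)
    {n m : Γ} (hnm : n ≠ m) {z w : ℂ} (hz : ‖z‖ = 1) (hw : ‖w‖ = 1) {f : X →L[ℝ] ℝ}
    (hf : IsCoordinateFunctional Δ m w f) :
    f (Complex.I • (Δ (c0Unit n z hz) : X)) = 0 := by
  have hIw : ‖Complex.I * w‖ = 1 := by rw [norm_mul, Complex.norm_I, hw, one_mul]
  have hIw' : ‖-(Complex.I * w)‖ = 1 := by rwa [norm_neg]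
  obtain ⟨x, hx⟩ := exists_sphere_preimage hsurj
    (y := Complex.I • (Δ (c0Unit m (Complex.I * w) hIw) : X))
    (by rw [norm_smul, Complex.norm_I, norm_coe_sphere, one_mul])
  have hfx : |f (Δ x)| = 1 := by
    rcases I_smul_preimage_apply hΔ hsurj hIw hx with h | h
    · rw [hf.apply_eq x (-1) (by norm_num) (by
        rw [h, ← mul_assoc, Complex.I_mul_I]
        norm_num)]
      norm_num
    · rw [hf.apply_eq x 1 (by norm_num) (by
        rw [h, ← mul_assoc, Complex.I_mul_I]
        norm_num)]
      norm_num
  have hadd : ∀ (v : ℂ) (hv : ‖v‖ = 1),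
      |f (Complex.I • (Δ (c0Unit n z hz) : X) + Complex.I • (Δ (c0Unit m v hv) : X))| ≤ 1 := by
    intro v hv
    refine (hf.abs_le_norm _).trans ?_
    rw [← smul_add, norm_smul, Complex.norm_I, one_mul]
    exact norm_map_c0Unit_add_le hΔ hsurj hnm hz hv
  have h1 := hadd _ hIw
  have h2 := hadd _ hIw'
  rw [map_c0Unit_neg hΔ hsurj m hIw, smul_neg, ← hx, map_add, map_neg] at h2
  rw [← hx, map_add] at h1
  obtain ⟨h3, h4⟩ := abs_le.1 h1
  obtain ⟨h5, h6⟩ := abs_le.1 h2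
  rcases (abs_eq zero_le_one).1 hfx with h | h <;> rw [h] at h3 h4 h5 h6 <;> linarith

theorem smul_eq_re_smul_add_im_smul (a : ℂ) (v : X) :
    a • v = a.re • v + a.im • (Complex.I • v) := by
  conv_lhs => rw [← Complex.re_add_im a]
  rw [add_smul, mul_smul, Complex.coe_smul, Complex.coe_smul]

/-- A unimodular multiple of `Δ e_n` is again the image of a unimodular multiple of `e_n`. -/
theorem exists_map_c0Unit_eq_smul (hΔ : Isometry Δ) (hsurj : Function.Surjective Δ) (n : Γ)
    {a : ℂ} (ha : ‖a‖ = 1) :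
    ∃ (b : ℂ) (hb : ‖b‖ = 1), (Δ (c0Unit n b hb) : X) = a • (Δ (c0Unit n 1 norm_one) : X) := by
  obtain ⟨x, hx⟩ := exists_sphere_preimage hsurj (y := a • (Δ (c0Unit n 1 norm_one) : X))
    (by rw [norm_smul, ha, norm_coe_sphere, one_mul])
  have h0 : ∀ m, m ≠ n → (x : C₀(Γ, ℂ)) m = 0 := by
    intro m hm
    refine apply_eq_zero_of_functional_eq_zero hΔ hsurj x fun w f hw hf => ?_
    rw [hx, smul_eq_re_smul_add_im_smul, map_add, map_smul, map_smul,
      hf.apply_of_eq_zero (c0Unit_apply_of_ne 1 norm_one hm),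
      hf.apply_I_smul hΔ hsurj hm.symm norm_one hw, smul_zero, smul_zero, add_zero]
  have h1 : ‖(x : C₀(Γ, ℂ)) n‖ = 1 := by
    have hx1 := norm_coe_sphere x
    obtain ⟨m, hm⟩ := c0_exists_norm_apply_eq (x := (x : C₀(Γ, ℂ))) (by
      rw [← norm_ne_zero_iff, hx1]
      norm_num)
    by_cases hmn : m = n
    · rw [← hmn, hm, hx1]
    · rw [h0 m hmn, norm_zero, hx1] at hm
      norm_num at hm
  exact ⟨_, h1, by rw [← eq_c0Unit h1 rfl h0, hx]⟩

theorem c0Unit_one (n : Γ) : c0Unit n 1 norm_one = c0Basis n :=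
  Subtype.ext (one_smul ℂ _)

/-- On the circle through `e_n` the isometry is multiplication by the coordinate or by its
conjugate. -/
theorem exists_map_c0Unit_eq (hΔ : Isometry Δ) (hsurj : Function.Surjective Δ) (n : Γ) :
    ∃ σ : ℂ ≃ₗᵢ[ℝ] ℂ, ((∀ z, σ z = z) ∨ ∀ z, σ z = conj z) ∧
      ∀ (z : ℂ) (hz : ‖z‖ = 1), (Δ (c0Unit n z hz) : X) = σ z • (Δ (c0Basis n) : X) := by
  -- `s` runs in the inverse direction, `Δ (s a • e_n) = a • Δ e_n`; it is an isometry of the circle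
  -- fixing `1`, so `s I = ±I` decides everything.
  choose s hs hsΔ using fun (a : ℂ) (ha : ‖a‖ = 1) => exists_map_c0Unit_eq_smul hΔ hsurj n ha
  have hiso : ∀ a ha b hb, ‖s a ha - s b hb‖ = ‖a - b‖ := by
    intro a ha b hb
    rw [← norm_c0Unit_sub n (hs a ha) (hs b hb), ← norm_sub_of_sphere_isometry hΔ, hsΔ, hsΔ,
      ← sub_smul, norm_smul, norm_coe_sphere, mul_one]
  have h1 : s 1 norm_one = 1 := by
    have h := hsΔ 1 norm_one
    rw [one_smul] at h
    have h' : c0Unit n (s 1 norm_one) (hs 1 norm_one) = c0Unit n 1 norm_one :=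
      hΔ.injective (Subtype.ext h)
    rw [← c0Unit_apply_self n (s 1 norm_one) (hs 1 norm_one), h', c0Unit_apply_self]
  have hs1 : ∀ a ha, ‖s a ha - 1‖ = ‖a - 1‖ := fun a ha => by
    rw [← hiso a ha 1 norm_one, h1]
  have hI := I_smul_preimage_apply hΔ hsurj norm_one (hsΔ Complex.I Complex.norm_I)
  rw [c0Unit_apply_self, mul_one] at hI
  rcases hI with hI | hI
  · refine ⟨LinearIsometryEquiv.refl ℝ ℂ, Or.inl fun z => rfl, fun z hz => ?_⟩
    have h : s z hz = z := Complex.eq_of_norm_sub_one_of_norm_sub_I (hs z hz) hz (hs1 z hz) (by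
      rw [← hiso z hz Complex.I Complex.norm_I, hI])
    have h' := hsΔ z hz
    simp only [h, c0Unit_one] at h'
    exact h'
  · refine ⟨Complex.conjLIE, Or.inr fun z => rfl, fun z hz => ?_⟩
    have hz' : ‖conj z‖ = 1 := by rwa [Complex.norm_conj]
    have h : s (conj z) hz' = z := by
      refine Complex.eq_of_norm_sub_one_of_norm_sub_I (hs _ hz') hz ?_ ?_
      · rw [hs1, ← Complex.norm_conj, map_sub, Complex.conj_conj, map_one]
      · have hnI : ‖-Complex.I‖ = 1 := by rw [norm_neg, Complex.norm_I]
        have hsI : s (-Complex.I) hnI = Complex.I := by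
          have h3 := hsΔ (-Complex.I) hnI
          rw [neg_smul, ← hsΔ Complex.I Complex.norm_I] at h3
          simp only [hI] at h3
          rw [map_c0Unit_neg hΔ hsurj n Complex.norm_I, neg_neg] at h3
          have h4 : c0Unit n (s (-Complex.I) hnI) (hs _ hnI) = c0Unit n Complex.I Complex.norm_I :=
            hΔ.injective (Subtype.ext h3)
          rw [← c0Unit_apply_self n (s (-Complex.I) hnI) (hs _ hnI), h4, c0Unit_apply_self]
        have h5 := hiso (conj z) hz' (-Complex.I) hnI
        rw [hsI] at h5
        rw [h5, ← Complex.norm_conj, map_sub, Complex.conj_conj, map_neg, Complex.conj_I, neg_neg]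
    have h' := hsΔ (conj z) hz'
    simp only [h, c0Unit_one] at h'
    exact h'

end Coordinates

/-! ### The coordinate series and its agreement with `Δ` -/

section Extension

variable {Γ : Type*} [TopologicalSpace Γ] [DiscreteTopology Γ]
  {X : Type*} [NormedAddCommGroup X] [NormedSpace ℂ X]
  {Δ : Metric.sphere (0 : C₀(Γ, ℂ)) 1 → Metric.sphere (0 : X) 1}
  {σ : Γ → ℂ ≃ₗᵢ[ℝ] ℂ}

theorem IsCoordinateFunctional.apply_smul_self {n : Γ} {z : ℂ} {f : X →L[ℝ] ℝ}
    (hf : IsCoordinateFunctional Δ n z f) (hz : ‖z‖ = 1)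
    (hσ : ∀ (n : Γ) (z : ℂ) (hz : ‖z‖ = 1),
      (Δ (c0Unit n z hz) : X) = σ n z • (Δ (c0Basis n) : X)) (w : ℂ) :
    f (σ n w • (Δ (c0Basis n) : X)) = (conj z * w).re := by
  let g : ℂ →ₗ[ℝ] ℝ :=
    { toFun := fun w => f (σ n w • (Δ (c0Basis n) : X))
      map_add' := fun a b => by rw [map_add, add_smul, map_add]
      map_smul' := fun r a => by
        rw [(σ n).map_smul, smul_assoc, map_smul, RingHom.id_apply] }
  refine Complex.functional_eq_re_conj_mul g (fun a => ?_) hz ?_ w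
  · refine (le_abs_self _).trans ((hf.abs_le_norm _).trans_eq ?_)
    rw [norm_smul, norm_coe_sphere, mul_one, LinearIsometryEquiv.norm_map]
  · change f (σ n z • (Δ (c0Basis n) : X)) = 1
    rw [← hσ n z hz]
    refine hf.apply_eq _ 1 (by norm_num) ?_
    rw [c0Unit_apply_self, Complex.ofReal_one, one_mul]

theorem IsCoordinateFunctional.apply_smul_of_ne {n m : Γ} {z : ℂ} {f : X →L[ℝ] ℝ}
    (hf : IsCoordinateFunctional Δ n z f)
    (hσ : ∀ (n : Γ) (z : ℂ) (hz : ‖z‖ = 1),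
      (Δ (c0Unit n z hz) : X) = σ n z • (Δ (c0Basis n) : X)) (hnm : n ≠ m) (w : ℂ) :
    f (σ m w • (Δ (c0Basis m) : X)) = 0 := by
  by_cases hw : w = 0
  · rw [hw, map_zero, zero_smul, map_zero]
  · obtain ⟨u, hu, hwu⟩ := Complex.exists_phase hw
    rw [hwu, ← Complex.real_smul, (σ m).map_smul, smul_assoc, ← hσ m u hu, map_smul,
      hf.apply_of_eq_zero (c0Unit_apply_of_ne u hu hnm), smul_zero]

theorem norm_sum_smul_le (hΔ : Isometry Δ) (hsurj : Function.Surjective Δ)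
    (hσ : ∀ (n : Γ) (z : ℂ) (hz : ‖z‖ = 1),
      (Δ (c0Unit n z hz) : X) = σ n z • (Δ (c0Basis n) : X)) (t : Finset Γ) (w : Γ → ℂ)
    {C : ℝ} (hC : 0 ≤ C) (hw : ∀ n ∈ t, ‖w n‖ ≤ C) :
    ‖∑ n ∈ t, σ n (w n) • (Δ (c0Basis n) : X)‖ ≤ C := by
  refine norm_le_of_functional_le hΔ hsurj hC fun n z f hz hf => ?_
  rw [map_sum]
  by_cases hn : n ∈ t
  · rw [Finset.sum_eq_single_of_mem n hn fun m _ hm => hf.apply_smul_of_ne hσ hm.symm _,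
      hf.apply_smul_self hz hσ]
    refine (Complex.re_le_norm _).trans ?_
    rw [norm_mul, Complex.norm_conj, hz, one_mul]
    exact hw n hn
  · rw [Finset.sum_eq_zero fun m hm => hf.apply_smul_of_ne hσ (fun h => hn (h ▸ hm)) _]
    exact hC

theorem summable_smul [CompleteSpace X] (hΔ : Isometry Δ) (hsurj : Function.Surjective Δ)
    (hσ : ∀ (n : Γ) (z : ℂ) (hz : ‖z‖ = 1),
      (Δ (c0Unit n z hz) : X) = σ n z • (Δ (c0Basis n) : X)) (x : C₀(Γ, ℂ)) :
    Summable fun n => σ n (x n) • (Δ (c0Basis n) : X) := by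
  rw [summable_iff_vanishing_norm]
  intro ε hε
  have hfin := (tendsto_cocompact_zero_iff_finite x).1 x.zero_at_infty' (ε / 2) (by positivity)
  refine ⟨hfin.toFinset, fun t ht => ?_⟩
  refine (norm_sum_smul_le hΔ hsurj hσ t x (C := ε / 2) (by positivity) fun n hn => ?_).trans_lt
    (by linarith)
  by_contra h
  exact Finset.disjoint_left.1 ht hn (hfin.mem_toFinset.2 (not_le.1 h).le)

theorem IsCoordinateFunctional.apply_tsum {n : Γ} {z : ℂ} {f : X →L[ℝ] ℝ}
    (hf : IsCoordinateFunctional Δ n z f) (hz : ‖z‖ = 1)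
    (hσ : ∀ (n : Γ) (z : ℂ) (hz : ‖z‖ = 1),
      (Δ (c0Unit n z hz) : X) = σ n z • (Δ (c0Basis n) : X)) {x : C₀(Γ, ℂ)} {y : X}
    (hy : HasSum (fun n => σ n (x n) • (Δ (c0Basis n) : X)) y) :
    f y = (conj z * x n).re := by
  refine (hy.mapL f).unique ?_
  rw [← hf.apply_smul_self hz hσ (x n)]
  exact hasSum_single n fun m hm => hf.apply_smul_of_ne hσ hm.symm _

theorem norm_eq_of_hasSum (hΔ : Isometry Δ) (hsurj : Function.Surjective Δ)
    (hσ : ∀ (n : Γ) (z : ℂ) (hz : ‖z‖ = 1),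
      (Δ (c0Unit n z hz) : X) = σ n z • (Δ (c0Basis n) : X)) {x : C₀(Γ, ℂ)} {y : X}
    (hy : HasSum (fun n => σ n (x n) • (Δ (c0Basis n) : X)) y) : ‖y‖ = ‖x‖ := by
  apply le_antisymm
  · refine norm_le_of_functional_le hΔ hsurj (norm_nonneg _) fun n z f hz hf => ?_
    rw [hf.apply_tsum hz hσ hy]
    refine (Complex.re_le_norm _).trans ?_
    rw [norm_mul, Complex.norm_conj, hz, one_mul]
    exact c0_norm_apply_le x n
  · refine c0_norm_le (norm_nonneg _) fun n => ?_
    by_cases hx : x n = 0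
    · rw [hx, norm_zero]
      exact norm_nonneg _
    · obtain ⟨z, hz, hxz⟩ := Complex.exists_phase hx
      obtain ⟨f, hf⟩ := exists_isCoordinateFunctional hΔ hsurj n hz
      have h := (le_abs_self _).trans (hf.abs_le_norm y)
      rw [hf.apply_tsum hz hσ hy, hxz, mul_left_comm, Complex.conj_mul', hz, Complex.ofReal_one,
        one_pow, mul_one, Complex.ofReal_re] at h
      exact h

/-- The sum is a unit vector, hence some `Δ x'`. Functionals with the phase of `x n` give `|x n| ≤
|x' n|`; those with the phase of `x' n` force equality, including of phases. -/
theorem map_eq_of_hasSum (hΔ : Isometry Δ) (hsurj : Function.Surjective Δ)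
    (hσ : ∀ (n : Γ) (z : ℂ) (hz : ‖z‖ = 1),
      (Δ (c0Unit n z hz) : X) = σ n z • (Δ (c0Basis n) : X))
    {x : Metric.sphere (0 : C₀(Γ, ℂ)) 1} {y : X}
    (hy : HasSum (fun n => σ n ((x : C₀(Γ, ℂ)) n) • (Δ (c0Basis n) : X)) y) : y = Δ x := by
  obtain ⟨x', hx'⟩ := exists_sphere_preimage hsurj (y := y)
    (by rw [norm_eq_of_hasSum hΔ hsurj hσ hy, norm_coe_sphere])
  have hle : ∀ n, ‖(x : C₀(Γ, ℂ)) n‖ ≤ ‖(x' : C₀(Γ, ℂ)) n‖ := by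
    intro n
    by_cases hx : (x : C₀(Γ, ℂ)) n = 0
    · rw [hx, norm_zero]
      exact norm_nonneg _
    · obtain ⟨z, hz, hxz⟩ := Complex.exists_phase hx
      obtain ⟨f, hf⟩ := exists_isCoordinateFunctional hΔ hsurj n hz
      have h := (le_abs_self _).trans (hf.abs_apply_le x')
      rw [hx', hf.apply_tsum hz hσ hy, hxz, mul_left_comm, Complex.conj_mul', hz,
        Complex.ofReal_one, one_pow, mul_one, Complex.ofReal_re] at h
      exact h
  suffices h : x = x' by rw [h, hx']
  refine Subtype.ext (ZeroAtInftyContinuousMap.ext fun n => ?_)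
  by_cases hx : (x' : C₀(Γ, ℂ)) n = 0
  · have := hle n
    rw [hx, norm_zero] at this
    rw [hx, norm_le_zero_iff.1 this]
  · obtain ⟨z, f, hz, hf, hxz, hfx⟩ := exists_functional_apply_eq_norm hΔ hsurj x' hx
    rw [hx', hf.apply_tsum hz hσ hy] at hfx
    have hzn : ‖conj z * (x : C₀(Γ, ℂ)) n‖ = ‖(x : C₀(Γ, ℂ)) n‖ := by
      rw [norm_mul, Complex.norm_conj, hz, one_mul]
    have hq : conj z * (x : C₀(Γ, ℂ)) n = (‖(x' : C₀(Γ, ℂ)) n‖ : ℂ) := by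
      have h1 : (conj z * (x : C₀(Γ, ℂ)) n).re = ‖conj z * (x : C₀(Γ, ℂ)) n‖ :=
        le_antisymm (Complex.re_le_norm _) (by rw [hzn, hfx]; exact hle n)
      refine Complex.ext (hfx.trans (Complex.ofReal_re _).symm) ?_
      rw [Complex.ofReal_im]
      refine Complex.abs_re_eq_norm.1 ?_
      rw [h1, abs_norm]
    rw [hxz, ← hq, mul_right_comm, Complex.conj_mul', hz]
    norm_num

/-- Apply a real-linear isometry of `ℂ` to each coordinate. -/
noncomputable def c0MapCoordinates (σ : Γ → ℂ ≃ₗᵢ[ℝ] ℂ) (x : C₀(Γ, ℂ)) : C₀(Γ, ℂ) where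
  toFun n := σ n (x n)
  continuous_toFun := continuous_of_discreteTopology
  zero_at_infty' := by
    rw [tendsto_cocompact_zero_iff_finite]
    simpa only [LinearIsometryEquiv.norm_map] using
      (tendsto_cocompact_zero_iff_finite x).1 x.zero_at_infty'

end Extension

/-! ### The extension theorem -/

theorem mainTheorem1 {Γ : Type*} [Infinite Γ] [TopologicalSpace Γ] [DiscreteTopology Γ]
    {X : Type*} [NormedAddCommGroup X] [NormedSpace ℂ X] [CompleteSpace X]
    (Δ : Metric.sphere (0 : C₀(Γ, ℂ)) 1 → Metric.sphere (0 : X) 1)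
    (hΔ : Isometry Δ) (hsurj : Function.Surjective Δ) :
    (∃ F : C₀(Γ, ℂ) ≃ₗᵢ[ℝ] X,
      (∀ x : Metric.sphere (0 : C₀(Γ, ℂ)) 1, F x = Δ x) ∧
      (∀ G : C₀(Γ, ℂ) ≃ₗᵢ[ℝ] X,
        (∀ x : Metric.sphere (0 : C₀(Γ, ℂ)) 1, G x = Δ x) → G = F) ∧
      ∃ σ : Γ → ℂ → ℂ,
        (∀ n : Γ, (∀ z : ℂ, σ n z = z) ∨ (∀ z : ℂ, σ n z = conj z)) ∧
        ∀ x : C₀(Γ, ℂ), HasSum (fun n : Γ => σ n (x n) • (Δ (c0Basis n) : X)) (F x)) ∧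
    Nonempty (C₀(Γ, ℂ) ≃ₗᵢ[ℂ] X) := by
  choose σ hσc hσ using exists_map_c0Unit_eq hΔ hsurj
  have hsum := fun x => (summable_smul hΔ hsurj hσ x).hasSum
  let F₀ : C₀(Γ, ℂ) →ₗᵢ[ℝ] X :=
    { toFun := fun x => ∑' n, σ n (x n) • (Δ (c0Basis n) : X)
      map_add' := fun x y => by
        refine HasSum.unique (hsum (x + y)) ?_
        simpa only [ZeroAtInftyContinuousMap.add_apply, map_add, add_smul] using
          (hsum x).add (hsum y)
      map_smul' := fun r x => by
        refine HasSum.unique (hsum (r • x)) ?_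
        simpa only [ZeroAtInftyContinuousMap.smul_apply, map_smul, smul_assoc,
          RingHom.id_apply] using
          (hsum x).const_smul r
      norm_map' := fun x => norm_eq_of_hasSum hΔ hsurj hσ (hsum x) }
  have hF₀ : ∀ x : Metric.sphere (0 : C₀(Γ, ℂ)) 1, F₀ x = Δ x := fun x =>
    map_eq_of_hasSum hΔ hsurj hσ (hsum x)
  have hF₀surj : Function.Surjective F₀ := by
    intro y
    by_cases hy : y = 0
    · exact ⟨0, by rw [hy, map_zero]⟩
    · have hy' := norm_ne_zero_iff.2 hy
      obtain ⟨x, hx⟩ := exists_sphere_preimage hsurj (y := ‖y‖⁻¹ • y) (by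
        rw [norm_smul, norm_inv, norm_norm, inv_mul_cancel₀ hy'])
      exact ⟨‖y‖ • (x : C₀(Γ, ℂ)), by rw [map_smul, hF₀, hx, smul_inv_smul₀ hy']⟩
  let F := LinearIsometryEquiv.ofSurjective F₀ hF₀surj
  refine ⟨⟨F, hF₀, fun G hG => ?_, fun n => σ n, hσc, hsum⟩, ?_⟩
  · ext x
    by_cases hx : x = 0
    · rw [hx, map_zero, map_zero]
    · have hx' := norm_ne_zero_iff.2 hx
      have hu : ‖x‖⁻¹ • x ∈ Metric.sphere (0 : C₀(Γ, ℂ)) 1 := by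
        rw [mem_sphere_zero_iff_norm, norm_smul, norm_inv, norm_norm, inv_mul_cancel₀ hx']
      have h : G (‖x‖⁻¹ • x) = F (‖x‖⁻¹ • x) := (hG ⟨_, hu⟩).trans (hF₀ ⟨_, hu⟩).symm
      rw [map_smul, map_smul] at h
      exact smul_right_injective X (inv_ne_zero hx') h
  · have hinv : ∀ n z, σ n (σ n z) = z := fun n z => by
      rcases hσc n with h | h <;> simp only [h, Complex.conj_conj]
    -- Each `σ n` is an involution, so precomposing with `T` cancels it and leaves the
    -- complex-linear series with terms `x n • Δ e_n`.
    let T := c0MapCoordinates σ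
    have hTT : ∀ x, T (T x) = x := fun x => ZeroAtInftyContinuousMap.ext fun n => hinv n (x n)
    have hsumT : ∀ x : C₀(Γ, ℂ), HasSum (fun n => x n • (Δ (c0Basis n) : X)) (F₀ (T x)) := by
      intro x
      have h : HasSum (fun n => σ n (σ n (x n)) • (Δ (c0Basis n) : X)) (F₀ (T x)) := hsum (T x)
      simpa only [hinv] using h
    have hTnorm : ∀ x, ‖T x‖ ≤ ‖x‖ := fun x => c0_norm_le (norm_nonneg _) fun n =>
      ((σ n).norm_map (x n)).trans_le (c0_norm_apply_le x n)
    let G : C₀(Γ, ℂ) →ₗᵢ[ℂ] X :=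
      { toFun := fun x => F₀ (T x)
        map_add' := fun x y => by
          refine HasSum.unique (hsumT (x + y)) ?_
          simpa only [ZeroAtInftyContinuousMap.add_apply, add_smul] using
            (hsumT x).add (hsumT y)
        map_smul' := fun r x => by
          refine HasSum.unique (hsumT (r • x)) ?_
          simpa only [ZeroAtInftyContinuousMap.smul_apply, smul_assoc,
            RingHom.id_apply] using
            (hsumT x).const_smul r
        norm_map' := fun x => (F₀.norm_map (T x)).trans <| (hTnorm x).antisymm <| by
          simpa only [hTT] using hTnorm (T x) }
    refine ⟨LinearIsometryEquiv.ofSurjective G fun y => ?_⟩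
    obtain ⟨x, hx⟩ := hF₀surj y
    exact ⟨T x, (congrArg F₀ (hTT x)).trans hx⟩
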